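/- Let $G=(V,E)$ be a finite undirected graph; loops, parallel edges, isolated vertices and disconnected graphs are allowed. The chromatic polynomial $P_G$ is the polynomial whose value at each $q\in\mathbb N$ is the number of colorings of $V$ in $q$ colors such that the ends of every edge have different colors. The graphic matroid $M_G=(E,r)$ has rank function $r(A)=|V(A)|-c(A)$, where $|V(A)|$ and $c(A)$ are the numbers of vertices and of connected components of the subgraph formed by the edges of $A\subseteq E$ and their ends. The flow polynomial $F_G$ is the characteristic polynomial of the dual matroid, $F_G(x)=\chi_{M_G^*}(x)$, where $\chi_M(x)=\sum_{A\subseteq E}(-1)^{|A|}x^{r_M(E)-r_M(A)}$. For a partition $\pi=\{V_1,\dots,V_m\}$ of $V$ into nonempty subsets (with $m$ arbitrary), let $A$ be the set of all edges of $G$ both of whose ends belong to the same $V_i$, let $H(A)$ be the union of the subgraphs $H_i$ with vertex set $V_i$ and all edges of $G$ with both ends in $V_i$, and let $G/H(A)$ be the factor graph: its vertices are $V_1,\dots,V_m$, its edges are the edges in $E\setminus A$, each of them joining the subsets that contain its two ends. Then $$F_G(x)=\frac{(-1)^{|E|}}{x^{|V|}}\sum_{\pi}(1-x)^{|A|}\,P_{G/H(A)}(x),$$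 where the sum is over all partitions $\pi$ of $V$ for which every subgraph $H_i$ is connected. The formula holds for every nonzero element $x$ of every field (in particular for every nonzero real $x$, and as an identity of rational functions in $x$). -/

import Mathlib

open scoped Graph Polynomial

/-! ### Matroids given by a rank function -/

namespace Matroid

variable {β : Type*}

/-- The three axioms of a rank function `r` on the subsets of the ground set `E`. -/
structure IsRankFun (E : Set β) (r : Set β → ℕ) : Prop where
  le_ncard : ∀ A, A ⊆ E → r A ≤ A.ncard
  mono : ∀ A B, A ⊆ B → B ⊆ E → r A ≤ r B
  submod : ∀ A B, A ⊆ E → B ⊆ E → r (A ∪ B) + r (A ∩ B) ≤ r A + r B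

namespace IsRankFun

variable {E : Set β} {r : Set β → ℕ}

lemma empty (h : IsRankFun E r) : r ∅ = 0 := by
  simpa using h.le_ncard ∅ (Set.empty_subset _)

lemma indep_subset (h : IsRankFun E r) (hE : E.Finite) {I J : Set β} (hJE : J ⊆ E)
    (hJ : r J = J.ncard) (hIJ : I ⊆ J) : r I = I.ncard := by
  have hfin := hE.subset hJE
  have h1 := h.submod I (J \ I) (hIJ.trans hJE) (Set.sdiff_subset.trans hJE)
  have h2 := h.le_ncard (J \ I) (Set.sdiff_subset.trans hJE)
  have h3 := h.le_ncard I (hIJ.trans hJE)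
  have h4 := Set.ncard_sdiff_add_ncard_of_subset hIJ hfin
  rw [Set.union_sdiff_cancel hIJ] at h1
  omega

lemma union_eq (h : IsRankFun E r) (hE : E.Finite) {I J : Set β} (hIE : I ⊆ E) (hJE : J ⊆ E)
    (hins : ∀ e ∈ J, r (insert e I) = r I) : r (I ∪ J) = r I := by
  induction J, hE.subset hJE using Set.Finite.induction_on with
  | empty => simp
  | @insert e J heJ hJ ih =>
    have hJE' : J ⊆ E := (Set.subset_insert _ _).trans hJE
    have heE : e ∈ E := hJE (Set.mem_insert _ _)
    have ih := ih hJE' fun f hf => hins f (Set.mem_insert_of_mem _ hf)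
    have he := hins e (Set.mem_insert _ _)
    have h1 := h.submod (I ∪ J) (insert e I) (Set.union_subset hIE hJE')
      (Set.insert_subset heE hIE)
    have h2 := h.mono I ((I ∪ J) ∩ insert e I)
      (Set.subset_inter Set.subset_union_left (Set.subset_insert _ _))
      (Set.inter_subset_left.trans (Set.union_subset hIE hJE'))
    have h3 := h.mono I (I ∪ insert e J) Set.subset_union_left (Set.union_subset hIE hJE)
    have h4 : (I ∪ J) ∪ insert e I = I ∪ insert e J := by
      ext x; simp only [Set.mem_union, Set.mem_insert_iff]; tauto
    rw [h4] at h1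
    omega

lemma insert_eq (h : IsRankFun E r) {I : Set β} (hIE : I ⊆ E)
    (hI : r I = I.ncard) {e : β} (he : e ∈ E)
    (hn : r (insert e I) ≠ (insert e I).ncard) : r (insert e I) = r I := by
  have h1 := h.le_ncard (insert e I) (Set.insert_subset he hIE)
  have h2 := h.mono I (insert e I) (Set.subset_insert _ _) (Set.insert_subset he hIE)
  have h3 := Set.ncard_insert_le e I
  omega

end IsRankFun

/-- The matroid on the finite ground set `E` with the rank function `r`; its independent sets are
the sets `I ⊆ E` with `r I = |I|`. -/
noncomputable def ofRankFun (E : Set β) (hE : E.Finite) (r : Set β → ℕ) (h : IsRankFun E r) :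
    Matroid β :=
  (IndepMatroid.ofFinite hE (fun I => I ⊆ E ∧ r I = I.ncard)
    ⟨Set.empty_subset _, by simpa using h.empty⟩
    (fun _ _ hJ hIJ => ⟨hIJ.trans hJ.1, h.indep_subset hE hJ.1 hJ.2 hIJ⟩)
    (by
      rintro I J ⟨hIE, hI⟩ ⟨hJE, hJ⟩ hlt
      by_contra! hcon
      have key : r (I ∪ J) = r I := by
        refine h.union_eq hE hIE hJE fun e he => ?_
        by_cases heI : e ∈ I
        · rw [Set.insert_eq_of_mem heI]
        · exact h.insert_eq hIE hI (hJE he)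
            (hcon e he heI (Set.insert_subset (hJE he) hIE))
      have := h.mono J (I ∪ J) Set.subset_union_right (Set.union_subset hIE hJE)
      omega)
    (fun _ hI => hI.1)).matroid

@[simp] lemma ofRankFun_E (E : Set β) (hE : E.Finite) (r : Set β → ℕ) (h : IsRankFun E r) :
    (ofRankFun E hE r h).E = E := rfl

lemma ofRankFun_indep (E : Set β) (hE : E.Finite) (r : Set β → ℕ) (h : IsRankFun E r)
    (I : Set β) : (ofRankFun E hE r h).Indep I ↔ I ⊆ E ∧ r I = I.ncard := by
  simp [ofRankFun]

instance ofRankFun_finite (E : Set β) (hE : E.Finite) (r : Set β → ℕ) (h : IsRankFun E r) :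
    (ofRankFun E hE r h).Finite := ⟨hE⟩

/-- The rank function of `Matroid.ofRankFun` is the given one. -/
lemma ofRankFun_eRk (E : Set β) (hE : E.Finite) (r : Set β → ℕ) (h : IsRankFun E r)
    {A : Set β} (hA : A ⊆ E) : (ofRankFun E hE r h).eRk A = r A := by
  obtain ⟨I, hI⟩ := (ofRankFun E hE r h).exists_isBasis A hA
  have hi := (ofRankFun_indep E hE r h I).1 hI.indep
  have hfin := hE.subset hi.1
  rw [hI.eRk_eq_encard, ← hfin.cast_ncard_eq, ← hi.2]
  have key : r (I ∪ A) = r I := by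
    refine h.union_eq hE hi.1 hA fun e he => ?_
    by_cases heI : e ∈ I
    · rw [Set.insert_eq_of_mem heI]
    · refine h.insert_eq hi.1 hi.2 (hA he) fun hn => heI ?_
      exact hI.mem_of_insert_indep he
        ((ofRankFun_indep E hE r h _).2 ⟨Set.insert_subset (hA he) hi.1, hn⟩)
  rw [Set.union_eq_self_of_subset_left hI.subset] at key
  rw [key]

/-- The characteristic polynomial `∑_{A ⊆ E} (-1)^|A| x^(r(E) - r(A))` of a finite matroid. -/
noncomputable def charPoly (M : Matroid β) [M.Finite] : ℤ[X] :=
  ∑ A ∈ M.ground_finite.toFinset.powerset,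
    (-1) ^ A.card * Polynomial.X ^ (M.eRank.toNat - (M.eRk (A : Set β)).toNat)

end Matroid

namespace Graph

variable {α β : Type*}

/-! ### Connectivity -/

/-- Two vertices are equivalent if they are joined by a walk. -/
def reachSetoid (G : Graph α β) : Setoid V(G) where
  r x y := Relation.ReflTransGen G.Adj x y
  iseqv :=
    { refl := fun _ => .refl
      symm := fun {x y} h => Relation.ReflTransGen.stdSymm.symm x.1 y.1 h
      trans := fun h h' => h.trans h' }

/-- The connected components of `G`. -/
abbrev Component (G : Graph α β) : Type _ := Quotient G.reachSetoid

/-- The number of connected components of `G`. -/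
noncomputable def numComponents (G : Graph α β) : ℕ := Nat.card G.Component

/-- A graph is connected if it has a vertex and any two vertices are joined by a walk. -/
def IsConnected (G : Graph α β) : Prop :=
  V(G).Nonempty ∧ ∀ x ∈ V(G), ∀ y ∈ V(G), Relation.ReflTransGen G.Adj x y

/-- Functions that are constant along the edges are the functions on the set of components. -/
def constEquiv (G : Graph α β) (T : Type*) :
    {f : V(G) → T // ∀ x y : V(G), G.Adj x y → f x = f y} ≃ (G.Component → T) where
  toFun f := Quotient.lift f.1 (by
    have key : ∀ (a : V(G)) (y : α), Relation.ReflTransGen G.Adj a y →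
        ∀ hy : y ∈ V(G), f.1 a = f.1 ⟨y, hy⟩ := by
      intro a y h
      induction h with
      | refl => intro _; rfl
      | tail h1 h2 ih => intro hy; exact (ih h2.left_mem).trans (f.2 ⟨_, h2.left_mem⟩ ⟨_, hy⟩ h2)
    exact fun a b h => key a b h b.2)
  invFun g := ⟨fun x => g (Quotient.mk _ x), fun x y h =>
    congrArg g (Quotient.sound (Relation.ReflTransGen.single h))⟩
  left_inv _ := rfl
  right_inv g := by
    funext c
    induction c using Quotient.inductionOn
    rfl

/-! ### The graphic matroid and the flow polynomial -/

/-- The subgraph formed by a set `A` of edges and the ends of these edges. -/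
def edgeSubgraph (G : Graph α β) (A : Set β) : Graph α β :=
  (G.restrict A).induce {x | ∃ e ∈ A, G.Inc e x}

/-- The rank `|V(A)| - c(A)` of a set of edges. -/
noncomputable def cycleRank (G : Graph α β) (A : Set β) : ℕ :=
  V(G.edgeSubgraph A).ncard - (G.edgeSubgraph A).numComponents

/-- The vector space of functions that are constant along the edges. -/
def constSpace (G : Graph α β) : Submodule ℚ (V(G) → ℚ) where
  carrier := {f | ∀ x y : V(G), G.Adj x y → f x = f y}
  add_mem' hf hg x y h := by simp [hf x y h, hg x y h]
  zero_mem' _ _ _ := rfl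
  smul_mem' c f hf x y h := by simp [hf x y h]

lemma finrank_constSpace (G : Graph α β) [Finite V(G)] :
    Module.finrank ℚ G.constSpace = G.numComponents := by
  have : Fintype G.Component := Fintype.ofFinite _
  let L : G.constSpace ≃ₗ[ℚ] (G.Component → ℚ) :=
    { G.constEquiv ℚ with
      map_add' := by
        intro f g; funext c; induction c using Quotient.inductionOn; rfl
      map_smul' := by
        intro a f; funext c; induction c using Quotient.inductionOn; rfl }
  rw [L.finrank_eq, Module.finrank_fintype_fun_eq_card, numComponents, Nat.card_eq_fintype_card]

lemma vertexSet_edgeSubgraph_subset (G : Graph α β) (A : Set β) :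
    V(G.edgeSubgraph A) ⊆ V(G) := fun _ ⟨_, _, h⟩ => h.vertex_mem

instance (G : Graph α β) [Finite V(G)] (A : Set β) : Finite V(G.edgeSubgraph A) :=
  (Set.toFinite V(G)).subset (G.vertexSet_edgeSubgraph_subset A)

instance (G : Graph α β) [Finite V(G)] (A : Set β) : Finite V(G.restrict A) :=
  inferInstanceAs (Finite V(G))

lemma numComponents_le (G : Graph α β) [Finite V(G)] : G.numComponents ≤ V(G).ncard := by
  rw [numComponents, ← Nat.card_coe_set_eq]
  exact Nat.card_le_card_of_surjective (Quotient.mk G.reachSetoid) Quotient.mk_surjective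

lemma edgeSubgraph_adj_iff (G : Graph α β) (A : Set β) (x y : α) :
    (G.edgeSubgraph A).Adj x y ↔ (G.restrict A).Adj x y := by
  constructor
  · rintro ⟨e, h⟩
    exact ⟨e, h.1⟩
  · rintro ⟨e, h⟩
    exact ⟨e, h, ⟨e, h.1, y, h.2⟩, ⟨e, h.1, x, h.2.symm⟩⟩

/-- Adding the other vertices of `G` to the subgraph formed by `A` adds isolated vertices only. -/
lemma edgeSubgraph_count (G : Graph α β) [Finite V(G)] (A : Set β) :
    V(G.edgeSubgraph A).ncard + (G.restrict A).numComponents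
      = V(G).ncard + (G.edgeSubgraph A).numComponents := by
  have hsub := G.vertexSet_edgeSubgraph_subset A
  classical
  let W : Set α := V(G) \ V(G.edgeSubgraph A)
  have : Finite W := (Set.toFinite V(G)).subset Set.sdiff_subset
  have hW : W.ncard + V(G.edgeSubgraph A).ncard = V(G).ncard :=
    Set.ncard_sdiff_add_ncard_of_subset hsub (Set.toFinite _)
  let e : {f : V(G.restrict A) → Bool // ∀ x y : V(G.restrict A), (G.restrict A).Adj x y → f x = f y}
      ≃ {f : V(G.edgeSubgraph A) → Bool //
          ∀ x y : V(G.edgeSubgraph A), (G.edgeSubgraph A).Adj x y → f x = f y} × (W → Bool) :=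
    { toFun := fun f => (⟨fun x => f.1 ⟨x.1, hsub x.2⟩, fun x y h =>
          f.2 ⟨x.1, hsub x.2⟩ ⟨y.1, hsub y.2⟩ ((G.edgeSubgraph_adj_iff A _ _).1 h)⟩,
        fun x => f.1 ⟨x.1, x.2.1⟩)
      invFun := fun p => ⟨fun x => if h : x.1 ∈ V(G.edgeSubgraph A) then p.1.1 ⟨x.1, h⟩
          else p.2 ⟨x.1, (x.2 : x.1 ∈ V(G)), h⟩, fun x y h => by
        have h' := (G.edgeSubgraph_adj_iff A _ _).2 h
        have hx : x.1 ∈ V(G.edgeSubgraph A) := h'.left_mem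
        have hy : y.1 ∈ V(G.edgeSubgraph A) := h'.right_mem
        simp only [hx, hy, dite_true]
        exact p.1.2 ⟨_, hx⟩ ⟨_, hy⟩ h'⟩
      left_inv := fun f => by
        ext x
        dsimp only
        split_ifs <;> rfl
      right_inv := fun p => by
        refine Prod.ext (Subtype.ext (funext fun x => ?_)) (funext fun x => ?_)
        · exact dif_pos x.2
        · exact dif_neg x.2.2 }
  have h := Nat.card_congr (((constEquiv _ Bool).symm.trans e).trans
    ((constEquiv _ Bool).prodCongr (Equiv.refl _)))
  have : Finite (G.edgeSubgraph A).Component := Quotient.finite _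
  have : Finite (G.restrict A).Component := Quotient.finite _
  rw [Nat.card_prod, Nat.card_fun, Nat.card_fun, Nat.card_fun, ← pow_add, Nat.card_eq_fintype_card,
    Fintype.card_bool] at h
  have h := Nat.pow_right_injective le_rfl h
  rw [Nat.card_coe_set_eq] at h
  simp only [numComponents]
  omega

/-- The rank in terms of the spanning subgraph with edge set `A`. -/
lemma cycleRank_add (G : Graph α β) [Finite V(G)] (A : Set β) :
    G.cycleRank A + (G.restrict A).numComponents = V(G).ncard := by
  have h1 := G.edgeSubgraph_count A
  have h2 := (G.edgeSubgraph A).numComponents_le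
  rw [cycleRank]
  omega

/-- The space of functions on the vertices of `G` that are constant along the edges in `A`. -/
def constSpaceOn (G : Graph α β) (A : Set β) : Submodule ℚ (V(G) → ℚ) :=
  (G.restrict A).constSpace

lemma mem_constSpaceOn (G : Graph α β) (A : Set β) (f : V(G) → ℚ) :
    f ∈ G.constSpaceOn A ↔ ∀ e ∈ A, ∀ x y : V(G), G.IsLink e x y → f x = f y :=
  ⟨fun h e he x y hl => h x y ⟨e, he, hl⟩, fun h x y ⟨e, he, hl⟩ => h e he x y hl⟩

lemma cycleRank_add_finrank (G : Graph α β) [Finite V(G)] (A : Set β) :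
    G.cycleRank A + Module.finrank ℚ (G.constSpaceOn A) = V(G).ncard := by
  rw [← G.cycleRank_add A, ← (G.restrict A).finrank_constSpace]
  rfl

lemma cycleRank_mono (G : Graph α β) [Finite V(G)] {A B : Set β} (h : A ⊆ B) :
    G.cycleRank A ≤ G.cycleRank B := by
  have h1 := G.cycleRank_add_finrank A
  have h2 := G.cycleRank_add_finrank B
  have h3 : G.constSpaceOn B ≤ G.constSpaceOn A := fun f hf =>
    (G.mem_constSpaceOn A f).2 fun e he => (G.mem_constSpaceOn B f).1 hf e (h he)
  have h4 := Submodule.finrank_mono h3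
  omega

lemma cycleRank_submod (G : Graph α β) [Finite V(G)] (A B : Set β) :
    G.cycleRank (A ∪ B) + G.cycleRank (A ∩ B) ≤ G.cycleRank A + G.cycleRank B := by
  have hA := G.cycleRank_add_finrank A
  have hB := G.cycleRank_add_finrank B
  have hU := G.cycleRank_add_finrank (A ∪ B)
  have hI := G.cycleRank_add_finrank (A ∩ B)
  have h1 := Submodule.finrank_sup_add_finrank_inf_eq (G.constSpaceOn A) (G.constSpaceOn B)
  have h2 : G.constSpaceOn A ⊓ G.constSpaceOn B = G.constSpaceOn (A ∪ B) := by
    ext f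
    simp only [Submodule.mem_inf, mem_constSpaceOn, Set.mem_union, or_imp, forall_and]
  have h3 : G.constSpaceOn A ⊔ G.constSpaceOn B ≤ G.constSpaceOn (A ∩ B) := by
    refine sup_le (fun f hf => ?_) (fun f hf => ?_)
    · exact (G.mem_constSpaceOn _ f).2 fun e he => (G.mem_constSpaceOn _ f).1 hf e he.1
    · exact (G.mem_constSpaceOn _ f).2 fun e he => (G.mem_constSpaceOn _ f).1 hf e he.2
  have h4 := Submodule.finrank_mono h3
  rw [h2] at h1
  omega

lemma cycleRank_empty (G : Graph α β) [Finite V(G)] : G.cycleRank ∅ = 0 := by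
  have h : V(G.edgeSubgraph ∅) = ∅ := by
    ext x
    simp [edgeSubgraph]
  simp [cycleRank, h]

lemma cycleRank_singleton_le (G : Graph α β) [Finite V(G)] (e : β) : G.cycleRank {e} ≤ 1 := by
  have hpos : V(G.edgeSubgraph {e}).Nonempty → 0 < (G.edgeSubgraph {e}).numComponents := by
    rintro ⟨x, hx⟩
    have : Finite (G.edgeSubgraph {e}).Component := Quotient.finite _
    have : Nonempty (G.edgeSubgraph {e}).Component := ⟨Quotient.mk _ ⟨x, hx⟩⟩
    exact Nat.card_pos
  have hcard : V(G.edgeSubgraph {e}).ncard ≤ 2 := by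
    by_cases he : e ∈ E(G)
    · obtain ⟨x, y, h⟩ := G.exists_isLink_of_mem_edgeSet he
      refine (Set.ncard_le_ncard (t := {x, y}) ?_ (Set.toFinite _)).trans ((Set.ncard_insert_le _ _).trans (by simp))
      rintro z ⟨f, rfl, hz⟩
      exact hz.eq_or_eq_of_isLink h
    · have : V(G.edgeSubgraph {e}) = ∅ := by
        ext z
        refine ⟨?_, fun h => h.elim⟩
        rintro ⟨f, rfl, hz⟩
        exact he hz.edge_mem
      simp [this]
  rw [cycleRank]
  rcases V(G.edgeSubgraph {e}).eq_empty_or_nonempty with h | h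
  · simp [h]
  · have := hpos h
    omega

lemma isRankFun_cycleRank (G : Graph α β) [Finite V(G)] [Finite E(G)] :
    Matroid.IsRankFun E(G) G.cycleRank where
  mono _ _ h _ := G.cycleRank_mono h
  submod A B _ _ := G.cycleRank_submod A B
  le_ncard A hA := by
    have hfin : A.Finite := (Set.toFinite E(G)).subset hA
    clear hA
    induction A, hfin using Set.Finite.induction_on with
    | empty => simp [cycleRank_empty]
    | @insert e A he hA ih =>
      have h1 := G.cycleRank_submod {e} A
      have h2 := G.cycleRank_singleton_le e
      rw [Set.singleton_union] at h1
      rw [Set.ncard_insert_of_notMem he hA]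
      omega

/-- The graphic matroid `M_G`: its ground set is the edge set, its rank function is
`A ↦ |V(A)| - c(A)`. -/
noncomputable def cycleMatroid (G : Graph α β) [Finite V(G)] [Finite E(G)] : Matroid β :=
  Matroid.ofRankFun E(G) (Set.toFinite _) G.cycleRank G.isRankFun_cycleRank

instance (G : Graph α β) [Finite V(G)] [Finite E(G)] : G.cycleMatroid.Finite :=
  Matroid.ofRankFun_finite _ _ _ _

lemma cycleMatroid_eRk (G : Graph α β) [Finite V(G)] [Finite E(G)] {A : Set β} (hA : A ⊆ E(G)) :
    G.cycleMatroid.eRk A = G.cycleRank A :=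
  Matroid.ofRankFun_eRk _ _ _ _ hA

/-- The flow polynomial: the characteristic polynomial of the dual of the graphic matroid. -/
noncomputable def flowPoly (G : Graph α β) [Finite V(G)] [Finite E(G)] : ℤ[X] :=
  G.cycleMatroid✶.charPoly

/-! ### The chromatic polynomial -/

/-- The proper colourings of the vertices of `G` in `q` colours. -/
def ProperColoring (G : Graph α β) (q : ℕ) : Type _ :=
  {f : V(G) → Fin q // ∀ x y : V(G), G.Adj x y → f x ≠ f y}

/-- The chromatic polynomial exists, and has an expansion over the sets of edges. -/
theorem chromatic_expansion (G : Graph α β) [Finite V(G)] [Finite E(G)] (q : ℕ) :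
    (∑ A ∈ (Set.toFinite E(G)).toFinset.powerset,
      (-1) ^ A.card * Polynomial.X ^ (G.restrict (A : Set β)).numComponents : ℤ[X]).eval (q : ℤ)
      = Nat.card (G.ProperColoring q) := by
  classical
  have : Fintype V(G) := Fintype.ofFinite _
  -- the edges on which a colouring is constant
  obtain ⟨mono, hmono⟩ : ∃ mono : (V(G) → Fin q) → Finset β, ∀ f e, e ∈ mono f ↔
      e ∈ E(G) ∧ ∀ x y : V(G), G.IsLink e x y → f x = f y :=
    ⟨fun f => (Set.toFinite E(G)).toFinset.filter fun e => ∀ x y : V(G), G.IsLink e x y → f x = f y,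
      fun f e => by simp⟩
  have hcount : ∀ A ∈ (Set.toFinite E(G)).toFinset.powerset,
      q ^ (G.restrict (A : Set β)).numComponents
        = (Finset.univ.filter fun f : V(G) → Fin q => A ⊆ mono f).card := by
    intro A hA
    have : Finite (G.restrict (A : Set β)).Component := Quotient.finite _
    have h := Nat.card_congr ((G.restrict (A : Set β)).constEquiv (Fin q))
    rw [Nat.card_fun, Nat.card_fin] at h
    rw [numComponents, ← h, ← Fintype.card_subtype, ← Nat.card_eq_fintype_card]
    refine Nat.card_congr (Equiv.subtypeEquivRight fun f => ?_)
    constructor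
    · intro hf e he
      exact (hmono f e).2 ⟨by simpa using Finset.mem_powerset.1 hA he, fun x y hl => hf x y ⟨e, he, hl⟩⟩
    · rintro hf x y ⟨e, he, hl⟩
      exact ((hmono f e).1 (hf he)).2 x y hl
  have hproper : Nat.card (G.ProperColoring q)
      = (Finset.univ.filter fun f : V(G) → Fin q => mono f = ∅).card := by
    rw [ProperColoring, ← Fintype.card_subtype, ← Nat.card_eq_fintype_card]
    refine Nat.card_congr (Equiv.subtypeEquivRight fun f => ?_)
    constructor
    · intro hf
      refine Finset.eq_empty_of_forall_notMem fun e he => ?_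
      rw [hmono] at he
      obtain ⟨x, y, hl⟩ := G.exists_isLink_of_mem_edgeSet he.1
      exact hf ⟨x, hl.left_mem⟩ ⟨y, hl.right_mem⟩ ⟨e, hl⟩ (he.2 _ _ hl)
    · rintro hf x y ⟨e, hl⟩ hxy
      refine Finset.notMem_empty e (hf ▸ (hmono f e).2 ⟨hl.edge_mem, ?_⟩)
      intro x' y' hl'
      rcases hl.eq_and_eq_or_eq_and_eq hl' with ⟨h1, h2⟩ | ⟨h1, h2⟩
      · rw [← Subtype.ext h1, ← Subtype.ext h2, hxy]
      · rw [← Subtype.ext h1, ← Subtype.ext h2, hxy]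
  rw [hproper, Polynomial.eval_finsetSum]
  simp only [Polynomial.eval_mul, Polynomial.eval_pow, Polynomial.eval_neg, Polynomial.eval_one,
    Polynomial.eval_X]
  have step : ∀ A ∈ (Set.toFinite E(G)).toFinset.powerset,
      (-1 : ℤ) ^ A.card * (q : ℤ) ^ (G.restrict (A : Set β)).numComponents
        = ∑ f : V(G) → Fin q, if A ⊆ mono f then (-1 : ℤ) ^ A.card else 0 := by
    intro A hA
    rw [← Nat.cast_pow, hcount A hA, ← Finset.sum_filter, Finset.sum_const, nsmul_eq_mul, mul_comm]
  rw [Finset.sum_congr rfl step, Finset.sum_comm, Finset.card_filter, Nat.cast_sum]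
  refine Finset.sum_congr rfl fun f _ => ?_
  rw [← Finset.sum_filter]
  have : (Set.toFinite E(G)).toFinset.powerset.filter (fun A => A ⊆ mono f)
      = (mono f).powerset := by
    ext A
    simp only [Finset.mem_filter, Finset.mem_powerset, and_iff_right_iff_imp]
    exact fun h e he => by simpa using ((hmono f e).1 (h he)).1
  rw [this, Finset.sum_powerset_neg_one_pow_card]
  split_ifs <;> simp

theorem exists_chromaticPoly (G : Graph α β) [Finite V(G)] [Finite E(G)] :
    ∃ P : ℤ[X], ∀ q : ℕ, P.eval (q : ℤ) = Nat.card (G.ProperColoring q) :=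
  ⟨_, G.chromatic_expansion⟩

/-- The chromatic polynomial: the polynomial whose value at every natural number `q` is the number
of proper colourings in `q` colours. -/
noncomputable def chromaticPoly (G : Graph α β) [Finite V(G)] [Finite E(G)] : ℤ[X] :=
  G.exists_chromaticPoly.choose

theorem chromaticPoly_eval (G : Graph α β) [Finite V(G)] [Finite E(G)] (q : ℕ) :
    G.chromaticPoly.eval (q : ℤ) = Nat.card (G.ProperColoring q) :=
  G.exists_chromaticPoly.choose_spec q

/-! ### Partitions into connected blocks and factor graphs -/

open Classical in
/-- The partitions of the vertex set into nonempty blocks `B` such that the subgraph formed by the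
vertices in `B` and all edges with both ends in `B` is connected. -/
noncomputable def connectedPartitions [DecidableEq α] (G : Graph α β) [Finite V(G)] :
    Finset (Finpartition (Set.toFinite V(G)).toFinset) :=
  Finset.univ.filter fun π => ∀ B ∈ π.parts, (G.induce (B : Set α)).IsConnected

/-- The set of the edges that have both ends in the same block. -/
def innerEdges [DecidableEq α] (G : Graph α β) [Finite V(G)]
    (π : Finpartition (Set.toFinite V(G)).toFinset) : Set β :=
  {e | ∃ B ∈ π.parts, e ∈ E(G.induce (B : Set α))}

/-- The factor graph: its vertices are the blocks, its edges are the edges of `G` that do not lie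
inside a block, each joining the blocks of its ends (parallel edges are kept). -/
noncomputable def factorGraph [DecidableEq α] (G : Graph α β) [Finite V(G)]
    (π : Finpartition (Set.toFinite V(G)).toFinset) : Graph (Finset α) β :=
  (G.deleteEdges (G.innerEdges π)).map π.part

instance [DecidableEq α] (G : Graph α β) [Finite V(G)] (π : Finpartition (Set.toFinite V(G)).toFinset) :
    Finite V(G.factorGraph π) :=
  (Set.toFinite V(G)).image π.part

instance [DecidableEq α] (G : Graph α β) [Finite V(G)] [Finite E(G)]
    (π : Finpartition (Set.toFinite V(G)).toFinset) : Finite E(G.factorGraph π) :=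
  (Set.toFinite E(G)).subset (deleteEdges_le (G := G)).edgeSet_mono

end Graph

/-!
The proof computes `∑ f, (1 - t) ^ |monoEdges f|` in two ways, where `f` runs over all colourings of
the vertices in `q` colours, proper or not, and `monoEdges f` is the set of edges whose ends have the
same colour.

Expanding each power over the subsets `A` of `monoEdges f` and counting the colourings that are
constant along `A` gives `∑ A, (-t) ^ |A| * q ^ k(A)`, where `k(A)` is the number of components of
the spanning subgraph with edge set `A` (`Graph.sum_colorings_eq_sum_edgeSets`).

On the other hand, a colouring is determined by the partition `π` of the vertices into the components
of its monochromatic subgraph, together with the proper colouring of the factor graph of `π` that it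
induces. All partitions into connected blocks and all proper colourings of their factor graphs occur
(`Graph.card_monoPartition_eq`), and `monoEdges f` is the set of edges inside the blocks
(`Graph.innerEdges_monoPartition`). This gives `∑ π, (1 - t) ^ |A_π| * P_{G/π}(q)`.

Both sums are polynomials in `q` over `ℤ[t]` that agree at every natural number, hence they are equal,
and `q` and `t` may be replaced by elements of any commutative ring
(`Graph.sum_edgeSets_eq_sum_partitions`). At `t = q = x` the first sum is
`(-1) ^ |E| * x ^ |V| * F_G(x)`, by the formula for the rank in the dual matroid
(`Graph.pow_mul_aeval_flowPoly`).
-/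

namespace Finpartition

lemma ext_part {α : Type*} [DecidableEq α] {s : Finset α} {P Q : Finpartition s}
    (h : ∀ a ∈ s, P.part a = Q.part a) : P = Q := by
  have key : ∀ R : Finpartition s, R.parts = s.image R.part := fun R => by
    ext p
    rw [Finset.mem_image]
    refine ⟨fun hp => R.part_surjOn hp, ?_⟩
    rintro ⟨a, ha, rfl⟩
    exact R.part_mem.2 ha
  ext1
  rw [key P, key Q]
  exact Finset.image_congr h

end Finpartition

namespace Graph

variable {α β : Type*}

/-! ### Colourings and their monochromatic edges -/

/-- The edges of `G` whose ends have the same colour under `f`; loops always belong to it. -/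
def monoEdges (G : Graph α β) {T : Type*} (f : V(G) → T) : Set β :=
  {e | e ∈ E(G) ∧ ∀ x y : V(G), G.IsLink e x y → f x = f y}

lemma monoEdges_subset (G : Graph α β) {T : Type*} (f : V(G) → T) : G.monoEdges f ⊆ E(G) :=
  fun _ h => h.1

lemma IsLink.mem_monoEdges_iff {G : Graph α β} {T : Type*} (f : V(G) → T) {e : β} {x y : V(G)}
    (hl : G.IsLink e x y) : e ∈ G.monoEdges f ↔ f x = f y := by
  refine ⟨fun h => h.2 x y hl, fun h => ⟨hl.edge_mem, fun x' y' hl' => ?_⟩⟩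
  rcases hl.eq_and_eq_or_eq_and_eq hl' with ⟨h1, h2⟩ | ⟨h1, h2⟩
  · rw [← Subtype.ext h1, ← Subtype.ext h2, h]
  · rw [← Subtype.ext h1, ← Subtype.ext h2, h]

/-- A colouring is constant on the edges in `A` iff it is a colouring of the components of the
spanning subgraph with edge set `A`. -/
lemma card_filter_subset_monoEdges [DecidableEq α] (G : Graph α β) [Fintype V(G)] (q : ℕ)
    {A : Set β} (hA : A ⊆ E(G)) [DecidablePred fun f : V(G) → Fin q => A ⊆ G.monoEdges f] :
    (Finset.univ.filter fun f : V(G) → Fin q => A ⊆ G.monoEdges f).card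
      = q ^ (G.restrict A).numComponents := by
  have : Finite (G.restrict A).Component := Quotient.finite _
  have h := Nat.card_congr ((G.restrict A).constEquiv (Fin q))
  rw [Nat.card_fun, Nat.card_fin] at h
  rw [numComponents, ← h, ← Fintype.card_subtype, ← Nat.card_eq_fintype_card]
  refine Nat.card_congr (Equiv.subtypeEquivRight fun f => ?_)
  constructor
  · rintro hf x y ⟨e, he, hl⟩
    exact (hf he).2 x y hl
  · intro hf e he
    exact ⟨hA he, fun x y hl => hf x y ⟨e, he, hl⟩⟩

/-- Expanding `(1 - t) ^ |monoEdges f|` over the sets of monochromatic edges. -/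
lemma sum_colorings_eq_sum_edgeSets [DecidableEq α] (G : Graph α β) [Fintype V(G)] [Finite E(G)]
    {R : Type*} [CommRing R] (t : R) (q : ℕ) :
    ∑ f : V(G) → Fin q, (1 - t) ^ (G.monoEdges f).ncard
      = ∑ A ∈ (Set.toFinite E(G)).toFinset.powerset,
          (-t) ^ A.card * (q : R) ^ (G.restrict (A : Set β)).numComponents := by
  classical
  have hfin (f : V(G) → Fin q) : (G.monoEdges f).Finite :=
    (Set.toFinite E(G)).subset (G.monoEdges_subset f)
  have h1 (f : V(G) → Fin q) : (1 - t) ^ (G.monoEdges f).ncard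
      = ∑ A ∈ (Set.toFinite E(G)).toFinset.powerset,
          if (A : Set β) ⊆ G.monoEdges f then (-t) ^ A.card else 0 := by
    rw [Set.ncard_eq_toFinset_card _ (hfin f), sub_eq_neg_add, ← Finset.sum_pow_mul_eq_add_pow,
      ← Finset.sum_filter]
    simp only [one_pow, mul_one]
    refine Finset.sum_congr ?_ fun _ _ => rfl
    ext A
    simp only [Finset.mem_filter, Finset.mem_powerset, Set.Finite.subset_toFinset]
    exact ⟨fun h => ⟨h.trans (G.monoEdges_subset f), h⟩, fun h => h.2⟩
  simp_rw [h1]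
  rw [Finset.sum_comm]
  refine Finset.sum_congr rfl fun A hA => ?_
  have hA' : (A : Set β) ⊆ E(G) := by simpa using hA
  rw [← Finset.sum_filter, Finset.sum_const, G.card_filter_subset_monoEdges q hA', nsmul_eq_mul,
    mul_comm, Nat.cast_pow]

lemma eq_of_reflTransGen_monoEdges {G : Graph α β} {T : Type*} {f : V(G) → T} {x y : α}
    (hx : x ∈ V(G)) (hy : y ∈ V(G)) (h : Relation.ReflTransGen (G.restrict (G.monoEdges f)).Adj x y) :
    f ⟨x, hx⟩ = f ⟨y, hy⟩ := by
  induction h with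
  | refl => rfl
  | @tail b c h1 h2 ih =>
    obtain ⟨e, he, hl⟩ := h2
    exact (ih hl.left_mem).trans (he.2 ⟨b, hl.left_mem⟩ ⟨c, hy⟩ hl)

/-! ### The partition into monochromatic components -/

lemma reflTransGen_adj_symm (G : Graph α β) {x y : α} (h : Relation.ReflTransGen G.Adj x y) :
    Relation.ReflTransGen G.Adj y x :=
  Relation.ReflTransGen.stdSymm.symm x y h

/-- Being joined by a walk in `G`, as an equivalence relation on the whole type of which `V(G)` is a
subset (an element outside `V(G)` is related to itself only). This is the form in which
`Finpartition.ofSetSetoid` takes it, in contrast to `Graph.reachSetoid`. -/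
def walkSetoid (G : Graph α β) : Setoid α where
  r := Relation.ReflTransGen G.Adj
  iseqv := ⟨fun _ => .refl, G.reflTransGen_adj_symm, fun h h' => h.trans h'⟩

open Classical in
/-- The partition of the vertices of `G` into the components of the spanning subgraph of the
monochromatic edges of `f`. -/
noncomputable def monoPartition [DecidableEq α] (G : Graph α β) [Finite V(G)] {T : Type*}
    (f : V(G) → T) : Finpartition (Set.toFinite V(G)).toFinset :=
  Finpartition.ofSetSetoid (G.restrict (G.monoEdges f)).walkSetoid _

section

variable [DecidableEq α] (G : Graph α β) [Finite V(G)] {T : Type*}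

lemma part_monoPartition_eq_iff (f : V(G) → T) {x y : α} (hx : x ∈ V(G)) (hy : y ∈ V(G)) :
    (G.monoPartition f).part x = (G.monoPartition f).part y ↔
      Relation.ReflTransGen (G.restrict (G.monoEdges f)).Adj x y := by
  rw [eq_comm, ← Finpartition.mem_part_iff_part_eq_part _ (by simpa) (by simpa), monoPartition,
    Finpartition.mem_part_ofSetSetoid_iff_rel]
  simp only [Set.Finite.mem_toFinset, hx, hy, true_and]
  rfl

variable {G} in
lemma IsLink.mem_innerEdges_iff (π : Finpartition (Set.toFinite V(G)).toFinset) {e : β} {x y : α}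
    (hl : G.IsLink e x y) : e ∈ G.innerEdges π ↔ π.part x = π.part y := by
  constructor
  · rintro ⟨B, hB, x', y', hl', hx, hy⟩
    rcases hl.eq_and_eq_or_eq_and_eq hl' with ⟨rfl, rfl⟩ | ⟨rfl, rfl⟩
    · rw [π.part_eq_of_mem hB hx, π.part_eq_of_mem hB hy]
    · rw [π.part_eq_of_mem hB hx, π.part_eq_of_mem hB hy]
  · intro h
    have hx : x ∈ (Set.toFinite V(G)).toFinset := by simpa using hl.left_mem
    have hy : y ∈ (Set.toFinite V(G)).toFinset := by simpa using hl.right_mem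
    exact ⟨π.part x, π.part_mem.2 hx, x, y, hl, π.mem_part hx, h ▸ π.mem_part hy⟩

lemma innerEdges_subset (π : Finpartition (Set.toFinite V(G)).toFinset) :
    G.innerEdges π ⊆ E(G) := by
  rintro e ⟨B, hB, x, y, hl, -⟩
  exact hl.edge_mem

/-- For the partition of a colouring, lying inside a block and being monochromatic are the same:
ends in one block are joined by a monochromatic walk, so they have the same colour. -/
lemma innerEdges_monoPartition (f : V(G) → T) :
    G.innerEdges (G.monoPartition f) = G.monoEdges f := by
  ext e
  by_cases he : e ∈ E(G)
  · obtain ⟨x, y, hl⟩ := G.exists_isLink_of_mem_edgeSet he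
    have hm := IsLink.mem_monoEdges_iff f (x := ⟨x, hl.left_mem⟩) (y := ⟨y, hl.right_mem⟩) hl
    rw [hl.mem_innerEdges_iff, G.part_monoPartition_eq_iff f hl.left_mem hl.right_mem]
    exact ⟨fun h => hm.2 (eq_of_reflTransGen_monoEdges _ _ h), fun h => .single ⟨e, h, hl⟩⟩
  · exact ⟨fun h => (he (G.innerEdges_subset _ h)).elim,
      fun h => (he (G.monoEdges_subset f h)).elim⟩

lemma monoPartition_mem_connectedPartitions (f : V(G) → T) :
    G.monoPartition f ∈ G.connectedPartitions := by
  simp only [connectedPartitions, Finset.mem_filter, Finset.mem_univ, true_and]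
  intro B hB
  have hBV : ∀ x ∈ B, x ∈ V(G) := fun x hx => by
    simpa using (G.monoPartition f).le hB hx
  refine ⟨(G.monoPartition f).nonempty_of_mem_parts hB, fun x hx y hy => ?_⟩
  have hx : x ∈ B := hx
  have hy : y ∈ B := hy
  have hmem {z : α} (hz : z ∈ V(G))
      (h : Relation.ReflTransGen (G.restrict (G.monoEdges f)).Adj x z) : z ∈ B := by
    rw [← Finpartition.part_eq_iff_mem _ hB, ← (G.part_monoPartition_eq_iff f (hBV x hx) hz).2 h]
    exact Finpartition.part_eq_of_mem _ hB hx
  have h := (G.part_monoPartition_eq_iff f (hBV x hx) (hBV y hy)).1 (by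
    rw [Finpartition.part_eq_of_mem _ hB hx, Finpartition.part_eq_of_mem _ hB hy])
  induction h with
  | refl => exact .refl
  | @tail b c h1 h2 ih =>
    obtain ⟨e, he, hl⟩ := id h2
    have hb := hmem hl.left_mem h1
    exact (ih hb hb).tail ⟨e, hl, hb, hy⟩

/-! ### Colourings of the factor graph -/

lemma part_mem_factorGraph (π : Finpartition (Set.toFinite V(G)).toFinset) (v : V(G)) :
    π.part v ∈ V(G.factorGraph π) :=
  ⟨v, v.2, rfl⟩

lemma factorGraph_adj (π : Finpartition (Set.toFinite V(G)).toFinset) {P Q : Finset α} :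
    (G.factorGraph π).Adj P Q ↔
      ∃ e x y, e ∉ G.innerEdges π ∧ G.IsLink e x y ∧ π.part x = P ∧ π.part y = Q := by
  constructor
  · rintro ⟨e, x, y, ⟨hl, he⟩, rfl, rfl⟩
    exact ⟨e, x, y, he, hl, rfl, rfl⟩
  · rintro ⟨e, x, y, he, hl, rfl, rfl⟩
    exact ⟨e, x, y, ⟨hl, he⟩, rfl, rfl⟩

/-- If the blocks of `π` are connected, then they are the monochromatic components of every
colouring of `G` that is induced by a proper colouring of the factor graph. -/
lemma monoPartition_comp_part {π : Finpartition (Set.toFinite V(G)).toFinset}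
    (hπ : π ∈ G.connectedPartitions) (g : V(G.factorGraph π) → T)
    (hg : ∀ P Q : V(G.factorGraph π), (G.factorGraph π).Adj P Q → g P ≠ g Q) :
    G.monoPartition (fun v => g ⟨π.part v, G.part_mem_factorGraph π v⟩) = π := by
  simp only [connectedPartitions, Finset.mem_filter, Finset.mem_univ, true_and] at hπ
  set f : V(G) → T := fun v => g ⟨π.part v, G.part_mem_factorGraph π v⟩ with hf
  -- A step between two blocks would be an edge of the factor graph, where `g` is proper; conversely
  -- a walk inside a block is monochromatic, and the block is connected.
  have key : ∀ x ∈ V(G), ∀ y ∈ V(G),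
      Relation.ReflTransGen (G.restrict (G.monoEdges f)).Adj x y ↔ π.part x = π.part y := by
    intro x hx y hy
    have hxs : x ∈ (Set.toFinite V(G)).toFinset := by simpa using hx
    have hys : y ∈ (Set.toFinite V(G)).toFinset := by simpa using hy
    constructor
    · intro h
      clear hy hys
      induction h with
      | refl => rfl
      | @tail b c h1 h2 ih =>
        obtain ⟨e, he, hl⟩ := h2
        rw [ih]
        by_contra hne
        refine hg ⟨_, G.part_mem_factorGraph π ⟨b, hl.left_mem⟩⟩
          ⟨_, G.part_mem_factorGraph π ⟨c, hl.right_mem⟩⟩ ((G.factorGraph_adj π).2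
            ⟨e, b, c, fun h => hne (hl.mem_innerEdges_iff π |>.1 h), hl, rfl, rfl⟩) ?_
        exact he.2 ⟨b, hl.left_mem⟩ ⟨c, hl.right_mem⟩ hl
    · intro h
      refine Relation.ReflTransGen.mono ?_ _ _ ((hπ _ (π.part_mem.2 hxs)).2 x (π.mem_part hxs) y
        (h ▸ π.mem_part hys))
      rintro b c ⟨e, hl, hb, hc⟩
      refine ⟨e, ?_, hl⟩
      refine (IsLink.mem_monoEdges_iff f (x := ⟨b, hl.left_mem⟩) (y := ⟨c, hl.right_mem⟩) hl).2 ?_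
      have hbc : π.part b = π.part c := by
        rw [π.part_eq_of_mem (π.part_mem.2 hxs) hb, π.part_eq_of_mem (π.part_mem.2 hxs) hc]
      simp only [hf, hbc]
  refine Finpartition.ext_part fun x hx => ?_
  ext y
  have hx' : x ∈ V(G) := by simpa using hx
  by_cases hy : y ∈ (Set.toFinite V(G)).toFinset
  · have hy' : y ∈ V(G) := by simpa using hy
    rw [Finpartition.mem_part_iff_part_eq_part _ hy hx,
      Finpartition.mem_part_iff_part_eq_part _ hy hx, part_monoPartition_eq_iff _ _ hy' hx',
      key y hy' x hx']
  · exact ⟨fun h => (hy (Finpartition.part_subset _ _ h)).elim,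
      fun h => (hy (Finpartition.part_subset _ _ h)).elim⟩

/-- The colourings with a given partition into connected monochromatic components correspond to the
proper colourings of the factor graph. -/
lemma card_monoPartition_eq {π : Finpartition (Set.toFinite V(G)).toFinset}
    (hπ : π ∈ G.connectedPartitions) (q : ℕ) :
    Nat.card {f : V(G) → Fin q // G.monoPartition f = π}
      = Nat.card ((G.factorGraph π).ProperColoring q) := by
  symm
  refine Nat.card_congr (Equiv.ofBijective (fun g : (G.factorGraph π).ProperColoring q =>
    ⟨_, G.monoPartition_comp_part hπ g.1 g.2⟩) ⟨?_, ?_⟩)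
  · intro g g' h
    refine Subtype.ext (funext ?_)
    rintro ⟨P, v, hv, rfl⟩
    exact congrFun (congrArg Subtype.val h) ⟨v, hv⟩
  · rintro ⟨f, rfl⟩
    choose r hr hr' using fun P : V(G.factorGraph (G.monoPartition f)) => P.2
    have hconst : ∀ v : V(G), f ⟨r ⟨_, G.part_mem_factorGraph _ v⟩, hr _⟩ = f v := fun v =>
      eq_of_reflTransGen_monoEdges (G := G) (hr _) v.2
      ((G.part_monoPartition_eq_iff f (hr _) v.2).1
        (hr' ⟨_, G.part_mem_factorGraph _ v⟩))
    -- the colour of a block is that of a chosen vertex in it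
    refine ⟨⟨fun P => f ⟨r P, hr P⟩, ?_⟩, Subtype.ext (funext hconst)⟩
    rintro ⟨P, hP⟩ ⟨Q, hQ⟩ h
    obtain ⟨e, x, y, he, hl, rfl, rfl⟩ := (G.factorGraph_adj _).1 h
    have hx := hconst ⟨x, hl.left_mem⟩
    have hy := hconst ⟨y, hl.right_mem⟩
    dsimp only at hx hy ⊢
    rw [hx, hy]
    rw [innerEdges_monoPartition] at he
    exact fun h => he
      ((IsLink.mem_monoEdges_iff f (x := ⟨x, hl.left_mem⟩) (y := ⟨y, hl.right_mem⟩) hl).2 h)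

/-- Summing over the colourings according to their partitions into monochromatic components. -/
lemma sum_colorings_eq_sum_partitions [Fintype V(G)] [Finite E(G)]
    {R : Type*} [CommRing R] (t : R) (q : ℕ) :
    ∑ f : V(G) → Fin q, (1 - t) ^ (G.monoEdges f).ncard
      = ∑ π ∈ G.connectedPartitions, (1 - t) ^ (G.innerEdges π).ncard *
          (((G.factorGraph π).chromaticPoly.eval (q : ℤ) : ℤ) : R) := by
  classical
  rw [← Finset.sum_fiberwise_of_maps_to
    (fun f _ => G.monoPartition_mem_connectedPartitions f)]
  refine Finset.sum_congr rfl fun π hπ => ?_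
  rw [chromaticPoly_eval, ← G.card_monoPartition_eq hπ q, Nat.card_eq_fintype_card,
    Fintype.card_subtype, Int.cast_natCast, mul_comm, ← nsmul_eq_mul, ← Finset.sum_const]
  refine Finset.sum_congr rfl fun f hf => ?_
  rw [← G.innerEdges_monoPartition f, (Finset.mem_filter.1 hf).2]

/-- The identity behind the theorem, with the number of colours and the edge variable independent
of one another: both sides are polynomials in the former that agree at every natural number. -/
theorem sum_edgeSets_eq_sum_partitions [Finite E(G)] {K : Type*} [CommRing K] (x t : K) :
    ∑ A ∈ (Set.toFinite E(G)).toFinset.powerset,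
        (-t) ^ A.card * x ^ (G.restrict (A : Set β)).numComponents
      = ∑ π ∈ G.connectedPartitions, (1 - t) ^ (G.innerEdges π).ncard *
          Polynomial.aeval x (G.factorGraph π).chromaticPoly := by
  have : Fintype V(G) := Fintype.ofFinite _
  -- The comparison at the natural numbers needs a domain in which these are distinct, which `K` need
  -- not be. So `t` is an indeterminate of `ℤ[X]` first, and both variables are specialised after.
  have key : (∑ A ∈ (Set.toFinite E(G)).toFinset.powerset,
        Polynomial.C ((-Polynomial.X) ^ A.card) *
          Polynomial.X ^ (G.restrict (A : Set β)).numComponents : ℤ[X][X])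
      = ∑ π ∈ G.connectedPartitions,
          Polynomial.C ((1 - Polynomial.X) ^ (G.innerEdges π).ncard) *
            (G.factorGraph π).chromaticPoly.map (Int.castRingHom ℤ[X]) := by
    refine Polynomial.eq_of_infinite_eval_eq _ _ ?_
    refine (Set.infinite_range_of_injective (Nat.cast_injective (R := ℤ[X]))).mono ?_
    rintro _ ⟨q, rfl⟩
    have h := (G.sum_colorings_eq_sum_edgeSets (Polynomial.X : ℤ[X]) q).symm.trans
      (G.sum_colorings_eq_sum_partitions (Polynomial.X : ℤ[X]) q)
    simpa [Polynomial.eval_finsetSum, Polynomial.eval_natCast_map] using h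
  have h := congrArg (Polynomial.eval₂RingHom (Polynomial.eval₂RingHom (Int.castRingHom K) t) x) key
  simp only [map_sum, map_mul, Polynomial.coe_eval₂RingHom, Polynomial.eval₂_C,
    Polynomial.eval₂_map, map_pow, map_neg, map_sub, map_one] at h
  simpa only [Polynomial.aeval_def, Polynomial.coe_eval₂RingHom, Polynomial.eval₂_X,
    Polynomial.eval₂_neg, Polynomial.eval₂_sub, Polynomial.eval₂_pow, Polynomial.eval₂_one,
    RingHom.ext_int ((Polynomial.eval₂RingHom (Int.castRingHom K) t).comp (Int.castRingHom ℤ[X]))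
      (algebraMap ℤ K)] using h

end

/-! ### The flow polynomial -/

/-- The rank-nullity expansion of the flow polynomial, cleared of denominators. The sets of edges
are replaced by their complements, which turns the corank in the dual into the nullity. -/
theorem pow_mul_aeval_flowPoly (G : Graph α β) [Finite V(G)] [Finite E(G)]
    {K : Type*} [CommRing K] (x : K) :
    x ^ V(G).ncard * Polynomial.aeval x G.flowPoly
      = (-1) ^ E(G).ncard * ∑ A ∈ (Set.toFinite E(G)).toFinset.powerset,
          (-x) ^ A.card * x ^ (G.restrict (A : Set β)).numComponents := by
  classical
  have hE : G.cycleMatroid✶.ground_finite.toFinset = (Set.toFinite E(G)).toFinset := by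
    ext; simp [cycleMatroid]
  rw [flowPoly, Matroid.charPoly, hE]
  set E := (Set.toFinite E(G)).toFinset with hEdef
  have hcard : E(G).ncard = E.card := Set.ncard_eq_toFinset_card _ _
  have hcoe : (E : Set β) = E(G) := by simp [hEdef]
  rw [map_sum, Finset.mul_sum, Finset.mul_sum]
  refine Finset.sum_bij' (fun A _ => E \ A) (fun A _ => E \ A) (by simp) (by simp)
    (fun A hA => Finset.sdiff_sdiff_eq_self (Finset.mem_powerset.1 hA))
    (fun A hA => Finset.sdiff_sdiff_eq_self (Finset.mem_powerset.1 hA)) fun A hA => ?_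
  rw [Finset.mem_powerset] at hA
  have hA' : (A : Set β) ⊆ E(G) := by rw [← hcoe]; exact_mod_cast hA
  have hC : ((E \ A : Finset β) : Set β) = E(G) \ A := by rw [Finset.coe_sdiff, hcoe]
  have h1 := G.cycleMatroid.eRk_dual_add_eRank (A : Set β) hA'
  have h2 := G.cycleMatroid.eRank_add_eRank_dual
  have hEE : G.cycleMatroid.E = E(G) := rfl
  rw [← Matroid.eRk_ground, hEE, G.cycleMatroid_eRk subset_rfl] at h1 h2
  rw [G.cycleMatroid_eRk Set.sdiff_subset, ← hC, Set.encard_coe_eq_coe_finsetCard] at h1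
  rw [← hcoe, Set.encard_coe_eq_coe_finsetCard, hcoe] at h2
  obtain ⟨a, ha⟩ := ENat.ne_top_iff_exists.1
    (G.cycleMatroid✶.isRkFinite_set (A : Set β)).eRk_lt_top.ne
  obtain ⟨b, hb⟩ := ENat.ne_top_iff_exists.1 (G.cycleMatroid✶.eRank_ne_top_iff.2 inferInstance)
  rw [← ha] at h1 ⊢
  rw [← hb] at h2 ⊢
  norm_cast at h1 h2
  simp only [ENat.toNat_natCast]
  have h3 := G.cycleRank_add ((E \ A : Finset β) : Set β)
  have h4 := Finset.card_sdiff_add_card_eq_card hA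
  have h5 := (G.isRankFun_cycleRank).le_ncard ((E \ A : Finset β) : Set β)
    (by rw [hC]; exact Set.sdiff_subset)
  rw [Set.ncard_coe_finset] at h5
  set k := (G.restrict ((E \ A : Finset β) : Set β)).numComponents
  have h6 : V(G).ncard + (b - a) = (E \ A).card + k := by omega
  rw [hcard, ← h4, neg_pow x]
  simp only [map_mul, map_pow, map_neg, map_one, Polynomial.aeval_X]
  have h7 : ((-1 : K) ^ (E \ A).card) * (-1) ^ (E \ A).card = 1 := by
    rw [← mul_pow]; simp
  calc _ = (-1) ^ A.card * x ^ (V(G).ncard + (b - a)) := by rw [pow_add]; ring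
    _ = (-1) ^ A.card * ((-1 : K) ^ (E \ A).card * (-1) ^ (E \ A).card)
        * x ^ ((E \ A).card + k) := by rw [h6, h7, mul_one]
    _ = _ := by rw [pow_add, pow_add]; ring

end Graph

theorem theorem2 {α β : Type*} [DecidableEq α] (G : Graph α β) [Finite V(G)] [Finite E(G)]
    {K : Type*} [Field K] (x : K) (hx : x ≠ 0) :
    Polynomial.aeval x G.flowPoly =
      (-1) ^ E(G).ncard / x ^ V(G).ncard *
        ∑ π ∈ G.connectedPartitions,
          (1 - x) ^ (G.innerEdges π).ncard * Polynomial.aeval x (G.factorGraph π).chromaticPoly := by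
  rw [← G.sum_edgeSets_eq_sum_partitions x x, div_mul_eq_mul_div, ← G.pow_mul_aeval_flowPoly,
    mul_div_cancel_left₀ _ (pow_ne_zero _ hx)]
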